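/- Let $\alpha,\beta,P,C,T>0$, $\pi_0\ge 0$, $\rho\in[0,1]$ and $x_0\in[0,1]$. Consider the optimal control problem $$\max\ \ \rho\,x(T)+\int_0^T\bigl(\alpha\,x(t)u(t)-C\,u(t)^2\bigr)\,dt\quad\text{subject to}\quad \dot x=\beta x(1-x)(Pu-\pi_0),\ \ x(0)=x_0,\ \ u(t)\in[0,1],$$ where the controls $u$ are measurable functions on $[0,T]$ with values in $[0,1]$, and $x$ is the corresponding continuous solution of the integrated equation $x(t)=x_0+\int_0^t\beta x(1-x)(Pu-\pi_0)\,ds$, $t\in[0,T]$. Let $(x,u)$ be an optimal pair, i.e. an admissible pair whose objective value is maximal among all admissible pairs, and let $[a,b]\subseteq[0,T]$, $a<b$, be a time interval on which the control lies in the interior of $[0,1]$, i.e. $0<u(t)<1$ for almost every $t\in[a,b]$ (for instance $[a,b]=[0,T]$). Then, on $[a,b]$, after modification of $u$ on a set of times of measure zero (no modification is needed if $u$ is continuous on $[a,b]$), $x$ and $u$ are differentiable at every time (one-sidedly at $a$ and $b$) and satisfy $$\dot x=\beta\,x(1-x)\,(Pu-\pi_0),\qquad \dot u=-\frac{\alpha\beta\pi_0}{2C}\,x(1-x).$$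 In particular $\dot u$ depends on the state alone, and the optimal effort $u$ is monotonically non-increasing on $[a,b]$. If moreover $\pi_0>0$ and $0<x_0<1$, then $\dot u<0$ on $[a,b]$ and $u$ is strictly decreasing there. -/

import Mathlib

open MeasureTheory Set

/-- `(x, u)` is an admissible pair on `[0, T]` for the controlled rumor-spreading dynamics
`ẋ = β x (1 - x) (P u - π₀)`, `x 0 = x₀`, `u ∈ [0, 1]`: the control is measurable, and the state is
the corresponding (Carathéodory) solution, i.e. a continuous function which satisfies the
integrated form of the initial value problem. -/
structure IsAdmissiblePair (β P π₀ x₀ T : ℝ) (x u : ℝ → ℝ) : Prop where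
  aemeasurable_control : AEMeasurable u (volume.restrict (Icc 0 T))
  control_mem : ∀ t ∈ Icc 0 T, u t ∈ Icc (0 : ℝ) 1
  continuousOn_state : ContinuousOn x (Icc 0 T)
  state_eq : ∀ t ∈ Icc 0 T,
    x t = x₀ + ∫ s in (0 : ℝ)..t, β * (x s * (1 - x s)) * (P * u s - π₀)

/-- The objective `ρ x(T) + ∫₀ᵀ (α x u - C u²) dt`. -/
noncomputable def payoff (α C ρ T : ℝ) (x u : ℝ → ℝ) : ℝ :=
  ρ * x T + ∫ t in (0 : ℝ)..T, (α * x t * u t - C * u t ^ 2)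

/-- `(x, u)` is an optimal pair: it is admissible and its payoff is maximal among all
admissible pairs. -/
def IsOptimalPair (α β P π₀ C ρ x₀ T : ℝ) (x u : ℝ → ℝ) : Prop :=
  IsAdmissiblePair β P π₀ x₀ T x u ∧
    ∀ y w : ℝ → ℝ, IsAdmissiblePair β P π₀ x₀ T y w → payoff α C ρ T y w ≤ payoff α C ρ T x u

/-! The argument is a direct first variation, without costate. In logistic time `W t = ∫ β (P u -
π₀)` the state is explicit, `x = logisticFlow x₀ W` (`exp_integral_eq`). Writing `α x u` as `α/(βP)
· x Ẇ + (α π₀/P) x`, the first term integrates to a function of `W T`, so the payoff is a function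
of `W T` plus `∫ (α π₀/P) x - C u²` (`payoff_eq`). Perturbing `u` by `ε k` with `∫ k = 0` leaves `W
T` fixed. Differentiating at `ε = 0` and integrating by parts shows that `V + 2 C u` is orthogonal
to `k`, where `V = ∫ α β π₀ x (1 - x)` (`integral_mul_eq_zero`). One suitably weighted `k` forces `V
+ 2 C u` to be constant a.e. on the arc (`exists_ae_eq_const`). Solving for `u` gives the `C¹`
representative, and its sign properties follow from the range of the logistic flow. -/

/-! ### Calculus of absolutely continuous functions -/

theorem LipschitzOnWith.comp_absolutelyContinuousOnInterval {φ w : ℝ → ℝ} {K : NNReal}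
    {s : Set ℝ} {a b : ℝ} (hφ : LipschitzOnWith K φ s) (hw : AbsolutelyContinuousOnInterval w a b)
    (hs : MapsTo w (uIcc a b) s) : AbsolutelyContinuousOnInterval (fun t ↦ φ (w t)) a b := by
  rw [absolutelyContinuousOnInterval_iff] at hw ⊢
  intro ε hε
  -- Dividing by `K + 1` also covers `K = 0`.
  obtain ⟨δ, hδ, h⟩ := hw (ε / (K + 1)) (by positivity)
  refine ⟨δ, hδ, fun E hE hlt ↦ ?_⟩
  calc
    _ ≤ ∑ i ∈ Finset.range E.1, K * dist (w (E.2 i).1) (w (E.2 i).2) :=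
      Finset.sum_le_sum fun i hi ↦
        hφ.dist_le_mul _ (hs (hE.1 i hi).1) _ (hs (hE.1 i hi).2)
    _ = K * ∑ i ∈ Finset.range E.1, dist (w (E.2 i).1) (w (E.2 i).2) :=
      (Finset.mul_sum _ _ _).symm
    _ ≤ K * (ε / (K + 1)) := by gcongr; exact (h E hE hlt).le
    _ < (K + 1) * (ε / (K + 1)) := by gcongr; linarith
    _ = ε := by field

theorem ContDiff.comp_absolutelyContinuousOnInterval {φ w : ℝ → ℝ} {a b : ℝ}
    (hφ : ContDiff ℝ 1 φ) (hw : AbsolutelyContinuousOnInterval w a b) :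
    AbsolutelyContinuousOnInterval (fun t ↦ φ (w t)) a b := by
  obtain ⟨M, hM⟩ := hw.exists_bound
  obtain ⟨K, hK⟩ := hφ.contDiffOn.exists_lipschitzOnWith (s := Icc (-M) M) (by decide)
    (convex_Icc _ _) isCompact_Icc
  exact hK.comp_absolutelyContinuousOnInterval hw fun t ht ↦ abs_le.1 (hM t ht)

theorem AbsolutelyContinuousOnInterval.const_fun (c a b : ℝ) :
    AbsolutelyContinuousOnInterval (fun _ : ℝ ↦ c) a b :=
  (contDiff_const (n := 1) (𝕜 := ℝ) (E := ℝ)).contDiffOn.absolutelyContinuousOnInterval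

/-- Chain rule in integrated form along a primitive of an integrable function. -/
theorem integral_comp_primitive_mul {φ φ' g : ℝ → ℝ} {t : ℝ} (hφ : ContDiff ℝ 1 φ)
    (hφ' : ∀ z, HasDerivAt φ (φ' z) z) (hg : IntervalIntegrable g volume 0 t) :
    ∫ s in (0 : ℝ)..t, φ' (∫ r in (0 : ℝ)..s, g r) * g s
      = φ (∫ r in (0 : ℝ)..t, g r) - φ 0 := by
  have hw := hg.absolutelyContinuousOnInterval_intervalIntegral (c := 0) (by simp)
  have hac := hφ.comp_absolutelyContinuousOnInterval hw
  have := hac.integral_deriv_eq_sub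
  simp only [intervalIntegral.integral_same] at this
  rw [← this]
  refine intervalIntegral.integral_congr_ae ?_
  filter_upwards [hg.ae_hasDerivAt_integral] with s hs hst
  exact (((hφ' _).comp s (hs (uIoc_subset_uIcc hst) 0 (by simp))).deriv).symm

/-- A solution of the linear equation `ẏ = -y k` is a multiple of `exp (-∫ k)`. -/
theorem mul_exp_integral_eq {y h k : ℝ → ℝ} {y₀ T : ℝ} (hT : 0 ≤ T)
    (hh : IntervalIntegrable h volume 0 T) (hk : IntervalIntegrable k volume 0 T)
    (hy : ∀ t ∈ Icc 0 T, y t = y₀ + ∫ s in (0 : ℝ)..t, h s)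
    (hhk : ∀ t ∈ Icc 0 T, h t = -(y t * k t)) :
    ∀ t ∈ Icc 0 T, y t * Real.exp (∫ s in (0 : ℝ)..t, k s) = y₀ := by
  have hH := hh.absolutelyContinuousOnInterval_intervalIntegral (c := 0) (by simp)
  have hK := hk.absolutelyContinuousOnInterval_intervalIntegral (c := 0) (by simp)
  have hac := ((AbsolutelyContinuousOnInterval.const_fun y₀ 0 T).fun_add hH).fun_mul
    (Real.contDiff_exp.comp_absolutelyContinuousOnInterval hK)
  obtain ⟨c, hc⟩ := hac.const_of_ae_hasDerivAt_zero (by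
    filter_upwards [hh.ae_hasDerivAt_integral, hk.ae_hasDerivAt_integral] with t h1 h2 ht
    have d1 := (h1 ht 0 (by simp)).const_add y₀
    have d2 := (h2 ht 0 (by simp)).exp
    rw [uIcc_of_le hT] at ht
    convert! d1.mul d2 using 1
    rw [← hy t ht, hhk t ht]
    ring)
  rw [uIcc_of_le hT] at hc
  intro t ht
  rw [hy t ht, hc t ht, ← hc 0 (left_mem_Icc.2 hT)]
  simp

/-- Integration by parts for two primitives, the second of which vanishes at both ends. -/
theorem integral_mul_primitive_add_primitive_mul {p k : ℝ → ℝ} {T : ℝ}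
    (hp : IntervalIntegrable p volume 0 T) (hk : IntervalIntegrable k volume 0 T)
    (hkT : ∫ s in (0 : ℝ)..T, k s = 0) :
    ∫ t in (0 : ℝ)..T, (p t * (∫ s in (0 : ℝ)..t, k s) + (∫ s in (0 : ℝ)..t, p s) * k t) = 0 := by
  have hV := hp.absolutelyContinuousOnInterval_intervalIntegral (c := 0) (by simp)
  have hK := hk.absolutelyContinuousOnInterval_intervalIntegral (c := 0) (by simp)
  have := hV.integral_deriv_mul_eq_sub hK
  rw [hkT, intervalIntegral.integral_same, mul_zero, zero_mul, sub_zero] at this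
  refine (intervalIntegral.integral_congr_ae ?_).trans this
  filter_upwards [hp.ae_hasDerivAt_integral, hk.ae_hasDerivAt_integral] with t h1 h2 ht
  rw [(h1 (uIoc_subset_uIcc ht) 0 (by simp)).deriv, (h2 (uIoc_subset_uIcc ht) 0 (by simp)).deriv]

/-! ### The logistic flow -/

/-- The solution at logistic time `w` of the logistic equation with initial value `x₀`. -/
noncomputable def logisticFlow (x₀ w : ℝ) : ℝ :=
  x₀ * Real.exp w / (1 - x₀ + x₀ * Real.exp w)

theorem logistic_denom_pos {x₀ : ℝ} (hx₀ : x₀ ∈ Icc (0 : ℝ) 1) (w : ℝ) :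
    0 < 1 - x₀ + x₀ * Real.exp w := by
  rcases hx₀.1.eq_or_lt with h | h
  · simp [← h]
  · have := mul_pos h (Real.exp_pos w)
    linarith [hx₀.2]

theorem logisticFlow_mem_Icc {x₀ : ℝ} (hx₀ : x₀ ∈ Icc (0 : ℝ) 1) (w : ℝ) :
    logisticFlow x₀ w ∈ Icc (0 : ℝ) 1 := by
  have hD := logistic_denom_pos hx₀ w
  refine ⟨div_nonneg (mul_nonneg hx₀.1 (Real.exp_pos w).le) hD.le, ?_⟩
  rw [logisticFlow, div_le_one hD]
  linarith [hx₀.2]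

theorem logisticFlow_mem_Ioo {x₀ : ℝ} (hx₀ : x₀ ∈ Ioo (0 : ℝ) 1) (w : ℝ) :
    logisticFlow x₀ w ∈ Ioo (0 : ℝ) 1 := by
  have hD := logistic_denom_pos (Ioo_subset_Icc_self hx₀) w
  refine ⟨div_pos (mul_pos hx₀.1 (Real.exp_pos w)) hD, ?_⟩
  rw [logisticFlow, div_lt_one hD]
  linarith [hx₀.2]

theorem logisticFlow_zero (x₀ : ℝ) : logisticFlow x₀ 0 = x₀ := by simp [logisticFlow]

theorem contDiff_logisticFlow {x₀ : ℝ} (hx₀ : x₀ ∈ Icc (0 : ℝ) 1) :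
    ContDiff ℝ 1 (logisticFlow x₀) := by
  unfold logisticFlow
  exact (contDiff_const.mul Real.contDiff_exp).div
    (contDiff_const.add (contDiff_const.mul Real.contDiff_exp))
    fun w ↦ (logistic_denom_pos hx₀ w).ne'

theorem hasDerivAt_logisticFlow {x₀ : ℝ} (hx₀ : x₀ ∈ Icc (0 : ℝ) 1) (w : ℝ) :
    HasDerivAt (logisticFlow x₀) (logisticFlow x₀ w * (1 - logisticFlow x₀ w)) w := by
  have hD := (logistic_denom_pos hx₀ w).ne'
  have h1 := (Real.hasDerivAt_exp w).const_mul x₀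
  convert! h1.div (h1.const_add (1 - x₀)) hD using 1
  unfold logisticFlow
  field

theorem intervalIntegrable_of_mem_Icc {u : ℝ → ℝ} {T : ℝ} (hT : 0 ≤ T)
    (hu : AEMeasurable u (volume.restrict (Icc 0 T))) (hmem : ∀ t ∈ Icc 0 T, u t ∈ Icc (0 : ℝ) 1) :
    IntervalIntegrable u volume 0 T := by
  rw [intervalIntegrable_iff_integrableOn_Icc_of_le hT]
  refine Integrable.of_bound hu.aestronglyMeasurable 1 ?_
  filter_upwards [ae_restrict_mem measurableSet_Icc] with t ht
  rw [Real.norm_eq_abs, abs_le]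
  constructor <;> linarith [(hmem t ht).1, (hmem t ht).2]

/-! ### Admissible pairs in logistic time -/

section Admissible

variable {β P π₀ x₀ T : ℝ} {x u : ℝ → ℝ}

theorem intervalIntegrable_rate (β P π₀ : ℝ) (hu : IntervalIntegrable u volume 0 T) :
    IntervalIntegrable (fun s ↦ β * (P * u s - π₀)) volume 0 T :=
  ((hu.const_mul P).sub (by simp)).const_mul β

/-- Both `x` and `1 - x` solve linear equations, with rates `(1 - x) g` and `-x g` for `g = β (P u -
π₀)`. Solving both and adding eliminates `x`, so neither a uniqueness theorem nor an a priori bound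
on the state is needed. -/
theorem IsAdmissiblePair.exp_integral_eq (h : IsAdmissiblePair β P π₀ x₀ T x u) (hT : 0 ≤ T) :
    ∀ t ∈ Icc 0 T,
      Real.exp (∫ s in (0 : ℝ)..t, x s * (β * (P * u s - π₀)))
          = 1 - x₀ + x₀ * Real.exp (∫ s in (0 : ℝ)..t, β * (P * u s - π₀)) ∧
        x t = logisticFlow x₀ (∫ s in (0 : ℝ)..t, β * (P * u s - π₀)) := by
  have hu := intervalIntegrable_of_mem_Icc hT h.aemeasurable_control h.control_mem
  have hg := intervalIntegrable_rate β P π₀ hu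
  have hx : ContinuousOn x (uIcc 0 T) := by rw [uIcc_of_le hT]; exact h.continuousOn_state
  have hxg := hg.continuousOn_mul hx
  have hdx : IntervalIntegrable (fun s ↦ β * (x s * (1 - x s)) * (P * u s - π₀)) volume 0 T := by
    convert! hg.continuousOn_mul (hx.mul (continuousOn_const.sub hx) : ContinuousOn
      (fun s ↦ x s * (1 - x s)) _) using 2
    simp only [Pi.mul_apply]
    ring
  have h1 := mul_exp_integral_eq hT hdx (hxg.sub hg) h.state_eq (fun t _ ↦ by ring)
  have h2 := mul_exp_integral_eq (y := fun t ↦ 1 - x t) (y₀ := 1 - x₀) hT hdx.neg hxg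
    (fun t ht ↦ by
      simp only [Pi.neg_apply, intervalIntegral.integral_neg]
      rw [h.state_eq t ht]
      ring) (fun t _ ↦ by simp only [Pi.neg_apply]; ring)
  intro t ht
  have hsub : uIcc 0 t ⊆ uIcc 0 T := by
    rw [uIcc_of_le hT, uIcc_of_le ht.1]; exact Icc_subset_Icc_right ht.2
  have e1 := h1 t ht
  have e2 := h2 t ht
  rw [intervalIntegral.integral_sub (hxg.mono_set hsub) (hg.mono_set hsub), Real.exp_sub] at e1
  set I := ∫ s in (0 : ℝ)..t, x s * (β * (P * u s - π₀))
  set W := ∫ s in (0 : ℝ)..t, β * (P * u s - π₀)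
  have hW := Real.exp_pos W
  have e3 : x t * Real.exp I = x₀ * Real.exp W := by
    field_simp at e1
    linarith
  -- The sum of `e2` and `e3`; it also shows that the denominator of the flow is nonzero.
  have e4 : Real.exp I = 1 - x₀ + x₀ * Real.exp W := by linarith
  refine ⟨e4, ?_⟩
  rw [logisticFlow, ← e4, ← e3]
  field

/-- The payoff of an admissible pair, after removing the exact part of the integrand. -/
theorem IsAdmissiblePair.payoff_eq (h : IsAdmissiblePair β P π₀ x₀ T x u) (hT : 0 ≤ T)
    (hβ : β ≠ 0) (hP : P ≠ 0) (α C ρ : ℝ) :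
    payoff α C ρ T x u =
      ρ * logisticFlow x₀ (∫ s in (0 : ℝ)..T, β * (P * u s - π₀))
        + α / (β * P) * Real.log (1 - x₀ + x₀ * Real.exp (∫ s in (0 : ℝ)..T, β * (P * u s - π₀)))
        + ∫ t in (0 : ℝ)..T, (α * π₀ / P *
            logisticFlow x₀ (∫ s in (0 : ℝ)..t, β * (P * u s - π₀)) - C * u t ^ 2) := by
  have hu := intervalIntegrable_of_mem_Icc hT h.aemeasurable_control h.control_mem
  have hu2 := intervalIntegrable_of_mem_Icc (u := fun t ↦ u t ^ 2) hT
    (h.aemeasurable_control.pow_const 2) fun t ht ↦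
      ⟨sq_nonneg _, pow_le_one₀ (h.control_mem t ht).1 (h.control_mem t ht).2⟩
  have hg := intervalIntegrable_rate β P π₀ hu
  have hx : ContinuousOn x (uIcc 0 T) := by rw [uIcc_of_le hT]; exact h.continuousOn_state
  have hxg := hg.continuousOn_mul hx
  obtain ⟨eT, eT'⟩ := h.exp_integral_eq hT T (right_mem_Icc.2 hT)
  -- The logarithm is `∫ x β (P u - π₀)`, so it can be merged back into the running payoff.
  rw [payoff, ← eT', ← eT, Real.log_exp, add_assoc, ← intervalIntegral.integral_const_mul,
    ← intervalIntegral.integral_add (hxg.const_mul _)]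
  · congr 1
    refine intervalIntegral.integral_congr fun t ht ↦ ?_
    rw [uIcc_of_le hT] at ht
    rw [← (h.exp_integral_eq hT t ht).2]
    field
  · refine IntervalIntegrable.sub ?_ (hu2.const_mul C)
    refine (hx.intervalIntegrable.const_mul (α * π₀ / P)).congr_ae ?_
    filter_upwards [ae_restrict_mem measurableSet_uIoc] with t ht
    rw [← (h.exp_integral_eq hT t (uIcc_of_le hT ▸ uIoc_subset_uIcc ht)).2]

/-- Every measurable control is part of an admissible pair. -/
theorem isAdmissiblePair_logisticFlow (hT : 0 ≤ T) (hx₀ : x₀ ∈ Icc (0 : ℝ) 1)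
    (hum : AEMeasurable u (volume.restrict (Icc 0 T)))
    (hu01 : ∀ t ∈ Icc 0 T, u t ∈ Icc (0 : ℝ) 1) :
    IsAdmissiblePair β P π₀ x₀ T
      (fun t ↦ logisticFlow x₀ (∫ s in (0 : ℝ)..t, β * (P * u s - π₀))) u := by
  have hg := intervalIntegrable_rate β P π₀ (intervalIntegrable_of_mem_Icc hT hum hu01)
  have hw := hg.absolutelyContinuousOnInterval_intervalIntegral (c := 0) (by simp)
  refine ⟨hum, hu01, ?_, fun t ht ↦ ?_⟩
  · rw [← uIcc_of_le hT]
    exact (contDiff_logisticFlow hx₀).continuous.comp_continuousOn hw.continuousOn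
  · have hsub : uIcc 0 t ⊆ uIcc 0 T := by
      rw [uIcc_of_le hT, uIcc_of_le ht.1]; exact Icc_subset_Icc_right ht.2
    have := integral_comp_primitive_mul (contDiff_logisticFlow hx₀) (hasDerivAt_logisticFlow hx₀)
      (hg.mono_set hsub)
    rw [logisticFlow_zero] at this
    rw [← sub_eq_iff_eq_add', ← this]
    refine intervalIntegral.integral_congr fun s _ ↦ ?_
    ring

end Admissible

/-! ### First variation -/

/-- First variation of the payoff at an optimal control, along perturbations of mean zero. -/
theorem IsOptimalPair.integral_mul_eq_zero {α β P π₀ C ρ x₀ T : ℝ} {x u k : ℝ → ℝ}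
    (hopt : IsOptimalPair α β P π₀ C ρ x₀ T x u) (hT : 0 ≤ T) (hx₀ : x₀ ∈ Icc (0 : ℝ) 1)
    (hβ : β ≠ 0) (hP : P ≠ 0) {M δ : ℝ} (hδ : 0 < δ)
    (hkm : AEMeasurable k (volume.restrict (Icc 0 T))) (hkM : ∀ t ∈ Icc 0 T, |k t| ≤ M)
    (hk0 : ∫ t in (0 : ℝ)..T, k t = 0)
    (hk01 : ∀ ε, |ε| < δ → ∀ t ∈ Icc 0 T, u t + ε * k t ∈ Icc (0 : ℝ) 1) :
    ∫ t in (0 : ℝ)..T,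
      ((∫ s in (0 : ℝ)..t, α * β * π₀ * (x s * (1 - x s))) + 2 * C * u t) * k t = 0 := by
  obtain ⟨hadm, hmax⟩ := hopt
  have hum := hadm.aemeasurable_control
  have hu := intervalIntegrable_of_mem_Icc hT hum hadm.control_mem
  have hg := intervalIntegrable_rate β P π₀ hu
  have hx : ContinuousOn x (uIcc 0 T) := by rw [uIcc_of_le hT]; exact hadm.continuousOn_state
  have huIoc : uIoc 0 T ⊆ Icc 0 T := uIcc_of_le hT ▸ uIoc_subset_uIcc
  have hres : ∀ {f : ℝ → ℝ}, AEMeasurable f (volume.restrict (Icc 0 T)) →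
      AEStronglyMeasurable f (volume.restrict (uIoc 0 T)) := fun hf ↦
    (hf.mono_measure (Measure.restrict_mono huIoc le_rfl)).aestronglyMeasurable
  have hcont : ∀ {f : ℝ → ℝ}, ContinuousOn f (uIcc 0 T) →
      AEMeasurable f (volume.restrict (Icc 0 T)) := fun hf ↦
    (uIcc_of_le hT ▸ hf).aemeasurable measurableSet_Icc
  have hk : IntervalIntegrable k volume 0 T := by
    rw [intervalIntegrable_iff_integrableOn_Icc_of_le hT]
    refine Integrable.of_bound hkm.aestronglyMeasurable M ?_
    filter_upwards [ae_restrict_mem measurableSet_Icc] with t ht using hkM t ht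
  set W : ℝ → ℝ := fun t ↦ ∫ s in (0 : ℝ)..t, β * (P * u s - π₀) with hWdef
  set K : ℝ → ℝ := fun t ↦ ∫ s in (0 : ℝ)..t, k s with hKdef
  have hW : ContinuousOn W (uIcc 0 T) :=
    (hg.absolutelyContinuousOnInterval_intervalIntegral (c := 0) (by simp)).continuousOn
  have hK : ContinuousOn K (uIcc 0 T) :=
    (hk.absolutelyContinuousOnInterval_intervalIntegral (c := 0) (by simp)).continuousOn
  have hS := contDiff_logisticFlow hx₀
  have hxW : ∀ t ∈ Icc 0 T, x t = logisticFlow x₀ (W t) := fun t ht ↦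
    (hadm.exp_integral_eq hT t ht).2
  have hWε : ∀ ε, ∀ t ∈ Icc 0 T,
      ∫ s in (0 : ℝ)..t, β * (P * (u s + ε * k s) - π₀) = W t + ε * (β * P * K t) := by
    intro ε t ht
    have hsub : uIcc 0 t ⊆ uIcc 0 T := by
      rw [uIcc_of_le hT, uIcc_of_le ht.1]; exact Icc_subset_Icc_right ht.2
    rw [hWdef, hKdef]
    simp only
    rw [← intervalIntegral.integral_const_mul, ← intervalIntegral.integral_const_mul,
      ← intervalIntegral.integral_add (hg.mono_set hsub)
        (((hk.mono_set hsub).const_mul _).const_mul _)]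
    exact intervalIntegral.integral_congr fun s _ ↦ by ring
  -- Mean zero fixes `W T`, so all terminal terms are independent of `ε`.
  have hKT : K T = 0 := hk0
  let F : ℝ → ℝ → ℝ := fun ε t ↦
    α * π₀ / P * logisticFlow x₀ (W t + ε * (β * P * K t)) - C * (u t + ε * k t) ^ 2
  let F' : ℝ → ℝ → ℝ := fun ε t ↦
    α * π₀ / P * (logisticFlow x₀ (W t + ε * (β * P * K t)) *
      (1 - logisticFlow x₀ (W t + ε * (β * P * K t))) * (β * P * K t)) -
      C * (2 * (u t + ε * k t) * k t)
  have hSW : ∀ ε, ContinuousOn (fun t ↦ logisticFlow x₀ (W t + ε * (β * P * K t))) (uIcc 0 T) :=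
    fun ε ↦ hS.continuous.comp_continuousOn
      (hW.add (continuousOn_const.mul (continuousOn_const.mul hK)))
  have huk : ∀ ε, AEMeasurable (fun t ↦ u t + ε * k t) (volume.restrict (Icc 0 T)) := fun ε ↦
    hum.add (hkm.const_mul ε)
  have hpay : ∀ ε, |ε| < δ → payoff α C ρ T
      (fun t ↦ logisticFlow x₀ (∫ s in (0 : ℝ)..t, β * (P * (u s + ε * k s) - π₀)))
      (fun t ↦ u t + ε * k t) =
      ρ * logisticFlow x₀ (W T) + α / (β * P) * Real.log (1 - x₀ + x₀ * Real.exp (W T))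
        + ∫ t in (0 : ℝ)..T, F ε t := by
    intro ε hε
    rw [(isAdmissiblePair_logisticFlow hT hx₀ (huk ε) (hk01 ε hε)).payoff_eq hT hβ hP,
      hWε ε T (right_mem_Icc.2 hT), hKT]
    simp only [mul_zero, add_zero]
    congr 1
    refine intervalIntegral.integral_congr fun t ht ↦ ?_
    rw [uIcc_of_le hT] at ht
    simp only [F]
    rw [hWε ε t ht]
  have hlocal : IsLocalMax (fun ε ↦ ∫ t in (0 : ℝ)..T, F ε t) 0 := by
    filter_upwards [Metric.ball_mem_nhds (0 : ℝ) hδ] with ε hε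
    have hε' : |ε| < δ := by simpa using hε
    have h1 := hmax _ _ (isAdmissiblePair_logisticFlow hT hx₀ (huk ε) (hk01 ε hε'))
    rw [hpay ε hε', hadm.payoff_eq hT hβ hP] at h1
    simp only [F, zero_mul, add_zero] at h1 ⊢
    exact le_of_add_le_add_left h1
  have hder := (intervalIntegral.hasDerivAt_integral_of_dominated_loc_of_deriv_le
    (F := F) (F' := F') (x₀ := 0) (a := 0) (b := T) (μ := volume)
    (bound := fun t ↦ |α * π₀ / P| * (|β * P| * |K t|) + |C| * (2 * M))
    (Metric.ball_mem_nhds (0 : ℝ) hδ) (.of_forall fun ε ↦ hres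
      (((hcont (hSW ε)).const_mul _).sub (((huk ε).pow_const 2).const_mul _))) ?_ ?_ ?_ ?_ ?_).2
  · have hz := hlocal.hasDerivAt_eq_zero hder
    have hp : IntervalIntegrable (fun s ↦ α * β * π₀ * (x s * (1 - x s))) volume 0 T :=
      (continuousOn_const.mul (hx.mul (continuousOn_const.sub hx))).intervalIntegrable
    -- This trades the nonlocal `K` in the derivative for `k` itself.
    have hparts := integral_mul_primitive_add_primitive_mul hp hk hk0
    have hV : ContinuousOn (fun t ↦ ∫ s in (0 : ℝ)..t, α * β * π₀ * (x s * (1 - x s)))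
        (uIcc 0 T) :=
      (hp.absolutelyContinuousOnInterval_intervalIntegral (c := 0) (by simp)).continuousOn
    have huk' : IntervalIntegrable (fun t ↦ 2 * C * u t * k t) volume 0 T := by
      rw [intervalIntegrable_iff_integrableOn_Icc_of_le hT]
      refine Integrable.of_bound ((hum.const_mul _).mul hkm).aestronglyMeasurable
        (|2 * C| * 1 * M) ?_
      filter_upwards [ae_restrict_mem measurableSet_Icc] with t ht
      have := hadm.control_mem t ht
      rw [Real.norm_eq_abs, abs_mul, abs_mul]
      have h1 : |u t| ≤ 1 := abs_le.2 ⟨by linarith [this.1], this.2⟩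
      gcongr
      exact hkM t ht
    have hpK : IntervalIntegrable (fun t ↦ α * β * π₀ * (x t * (1 - x t)) * K t) volume 0 T :=
      hp.mul_continuousOn hK
    rw [intervalIntegral.integral_add hpK (hk.continuousOn_mul hV)] at hparts
    have hsplit : ∫ t in (0 : ℝ)..T, F' 0 t =
        (∫ t in (0 : ℝ)..T, α * β * π₀ * (x t * (1 - x t)) * K t) -
          ∫ t in (0 : ℝ)..T, 2 * C * u t * k t := by
      rw [← intervalIntegral.integral_sub hpK huk']
      refine intervalIntegral.integral_congr fun t ht ↦ ?_
      rw [uIcc_of_le hT] at ht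
      simp only [F', zero_mul, add_zero, hxW t ht]
      field
    simp only [add_mul]
    rw [intervalIntegral.integral_add (hk.continuousOn_mul hV) huk']
    linarith
  · simp only [F, zero_mul, add_zero]
    refine ((hS.continuous.comp_continuousOn hW).intervalIntegrable.const_mul _).sub
      (IntervalIntegrable.const_mul ?_ _)
    exact intervalIntegrable_of_mem_Icc hT (hum.pow_const 2) fun t ht ↦
      ⟨sq_nonneg _, pow_le_one₀ (hadm.control_mem t ht).1 (hadm.control_mem t ht).2⟩
  · refine hres (AEMeasurable.sub (AEMeasurable.const_mul (hcont ?_) _) ?_)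
    · exact ((hSW 0).mul (continuousOn_const.sub (hSW 0))).mul (continuousOn_const.mul hK)
    · exact (((huk 0).const_mul 2).mul hkm).const_mul C
  · refine .of_forall fun t ht ε hε ↦ ?_
    have hε' : |ε| < δ := by simpa using hε
    have h1 := hk01 ε hε' t (huIoc ht)
    have h2 := logisticFlow_mem_Icc hx₀ (W t + ε * (β * P * K t))
    have h3 := hkM t (huIoc ht)
    simp only [F']
    generalize logisticFlow x₀ (W t + ε * (β * P * K t)) = z at h2 ⊢
    have hz : |z * (1 - z)| ≤ 1 := by
      rw [abs_of_nonneg (mul_nonneg h2.1 (sub_nonneg.2 h2.2))]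
      nlinarith [h2.1, h2.2]
    have hw : |u t + ε * k t| ≤ 1 := abs_le.2 ⟨by linarith [h1.1], h1.2⟩
    refine (norm_sub_le _ _).trans ?_
    simp only [Real.norm_eq_abs]
    refine add_le_add ?_ ?_
    · rw [abs_mul, abs_mul (z * (1 - z)), abs_mul (β * P)]
      exact mul_le_mul_of_nonneg_left (mul_le_of_le_one_left (by positivity) hz) (abs_nonneg _)
    · rw [abs_mul C, abs_mul _ (k t), abs_mul 2, abs_two]
      exact mul_le_mul_of_nonneg_left
        (mul_le_mul (by linarith) h3 (abs_nonneg _) zero_le_two) (abs_nonneg _)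
  · exact (((continuousOn_const.mul (continuousOn_const.mul hK.abs)).add
      continuousOn_const).intervalIntegrable)
  · refine .of_forall fun t _ ε _ ↦ ?_
    have d1 : HasDerivAt (fun ε ↦ W t + ε * (β * P * K t)) (β * P * K t) ε := by
      simpa using ((hasDerivAt_id ε).mul_const (β * P * K t)).const_add (W t)
    have d2 : HasDerivAt (fun ε ↦ u t + ε * k t) (k t) ε := by
      simpa using ((hasDerivAt_id ε).mul_const (k t)).const_add (u t)
    convert! (((hasDerivAt_logisticFlow hx₀ _).comp ε d1).const_mul (α * π₀ / P)).sub
      ((d2.pow 2).const_mul C) using 1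
    simp [F']

/-! ### From orthogonality to constancy -/

/-- A weighted fundamental lemma of the calculus of variations with a single test function: if the
bounded function `φ` is orthogonal to `ψ (φ - m)` for `m` its `ψ`-weighted mean, then it is almost
everywhere constant. -/
theorem exists_ae_eq_const_of_orthogonal {X : Type*} [MeasurableSpace X] {μ : Measure X}
    [IsFiniteMeasure μ] [NeZero μ] {φ ψ : X → ℝ} {A B : ℝ}
    (hφ : AEStronglyMeasurable φ μ) (hψ : AEStronglyMeasurable ψ μ)
    (hφb : ∀ᵐ t ∂μ, |φ t| ≤ A) (hψb : ∀ᵐ t ∂μ, |ψ t| ≤ B) (hpos : ∀ᵐ t ∂μ, 0 < ψ t)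
    (h : ∀ m, ∫ t, ψ t * (φ t - m) ∂μ = 0 → ∫ t, φ t * (ψ t * (φ t - m)) ∂μ = 0) :
    ∃ m, ∀ᵐ t ∂μ, φ t = m := by
  have iψ : Integrable ψ μ := .of_bound hψ B hψb
  have iψφ : Integrable (fun t ↦ ψ t * φ t) μ := iψ.mul_bdd hφ hφb
  have hA : ∫ t, ψ t ∂μ ≠ 0 := by
    intro h0
    rw [integral_eq_zero_iff_of_nonneg_ae (hpos.mono fun t ht ↦ ht.le) iψ] at h0
    obtain ⟨t, ht0, htp⟩ := (h0.and hpos).exists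
    exact htp.ne' ht0
  set m := (∫ t, ψ t * φ t ∂μ) / ∫ t, ψ t ∂μ with hm
  have iψm : Integrable (fun t ↦ ψ t * (φ t - m)) μ := by
    simp only [mul_sub]
    exact iψφ.sub (iψ.mul_const m)
  have h1 : ∫ t, ψ t * (φ t - m) ∂μ = 0 := by
    simp only [mul_sub]
    rw [integral_sub iψφ (iψ.mul_const m), integral_mul_const, hm]
    field
  have h2 := h m h1
  have i2 : Integrable (fun t ↦ φ t * (ψ t * (φ t - m))) μ := iψm.bdd_mul hφ hφb
  -- Subtracting `m` times `h1` from `h2` completes the square.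
  have h3 : ∫ t, ψ t * (φ t - m) ^ 2 ∂μ = 0 := by
    have : ∀ t, ψ t * (φ t - m) ^ 2 = φ t * (ψ t * (φ t - m)) - m * (ψ t * (φ t - m)) :=
      fun t ↦ by ring
    simp only [this]
    rw [integral_sub i2 (iψm.const_mul m), h2, integral_const_mul, h1]
    simp
  rw [integral_eq_zero_iff_of_nonneg_ae] at h3
  · refine ⟨m, ?_⟩
    filter_upwards [h3, hpos] with t ht hp
    simpa [hp.ne', sub_eq_zero] using ht
  · filter_upwards [hpos] with t ht
    exact mul_nonneg ht.le (sq_nonneg _)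
  · have : ∀ t, ψ t * (φ t - m) ^ 2 = φ t * (ψ t * (φ t - m)) - m * (ψ t * (φ t - m)) :=
      fun t ↦ by ring
    simp only [this]
    exact i2.sub (iψm.const_mul m)

theorem intervalIntegral_indicator_Icc {f : ℝ → ℝ} {a b T : ℝ} (ha : 0 ≤ a) (hb : b ≤ T)
    (hT : 0 ≤ T) :
    ∫ t in (0 : ℝ)..T, (Icc a b).indicator f t = ∫ t in Icc a b, f t := by
  rw [intervalIntegral.integral_of_le hT, ← integral_Icc_eq_integral_Ioc,
    setIntegral_indicator measurableSet_Icc, inter_eq_right.2 (Icc_subset_Icc ha hb)]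

theorem ContinuousOn.hasDerivWithinAt_integral_Icc {q : ℝ → ℝ} {a b t : ℝ}
    (hq : ContinuousOn q (Icc a b)) (ht : t ∈ Icc a b) :
    HasDerivWithinAt (fun r ↦ ∫ s in a..r, q s) (q t) (Icc a b) t := by
  -- Selects the filter instance giving one-sided derivatives at the endpoints.
  have : Fact (t ∈ Icc a b) := ⟨ht⟩
  refine intervalIntegral.integral_hasDerivWithinAt_right
    ((hq.mono ?_).intervalIntegrable) (t := Icc a b)
    (hq.stronglyMeasurableAtFilter_nhdsWithin measurableSet_Icc t) (hq t ht)
  rw [uIcc_of_le ht.1]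
  exact Icc_subset_Icc_right ht.2

/-- Along an interior arc, the optimal control differs from a primitive of `-x (1 - x)` only by
a constant. -/
theorem IsOptimalPair.exists_ae_eq_const {α β P π₀ C ρ x₀ T : ℝ} {x u : ℝ → ℝ}
    (hopt : IsOptimalPair α β P π₀ C ρ x₀ T x u) (hT : 0 ≤ T) (hx₀ : x₀ ∈ Icc (0 : ℝ) 1)
    (hβ : β ≠ 0) (hP : P ≠ 0) {a b : ℝ} (ha : 0 ≤ a) (hab : a < b) (hb : b ≤ T)
    (hint : ∀ᵐ t ∂(volume.restrict (Icc a b)), u t ∈ Ioo (0 : ℝ) 1) :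
    ∃ m, ∀ᵐ t ∂(volume.restrict (Icc a b)),
      (∫ s in (0 : ℝ)..t, α * β * π₀ * (x s * (1 - x s))) + 2 * C * u t = m := by
  have hadm := hopt.1
  have hum := hadm.aemeasurable_control
  have hsub : Icc a b ⊆ Icc 0 T := Icc_subset_Icc ha hb
  have hx : ContinuousOn x (uIcc 0 T) := by rw [uIcc_of_le hT]; exact hadm.continuousOn_state
  have hp : IntervalIntegrable (fun s ↦ α * β * π₀ * (x s * (1 - x s))) volume 0 T :=
    (continuousOn_const.mul (hx.mul (continuousOn_const.sub hx))).intervalIntegrable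
  set V : ℝ → ℝ := fun t ↦ ∫ s in (0 : ℝ)..t, α * β * π₀ * (x s * (1 - x s)) with hVdef
  have hVac := hp.absolutelyContinuousOnInterval_intervalIntegral (c := 0) (by simp)
  obtain ⟨B, hB⟩ := hVac.exists_bound
  have hVc := hVac.continuousOn
  rw [uIcc_of_le hT] at hB hVc
  set φ : ℝ → ℝ := fun t ↦ V t + 2 * C * u t with hφdef
  -- Since `u (1 - u)` is at most both `u` and `1 - u`, perturbations of this size keep the control
  -- in `[0, 1]`, even if `u` is not bounded away from `0` and `1`.
  set ψ : ℝ → ℝ := fun t ↦ u t * (1 - u t) with hψdef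
  have hφm : AEMeasurable φ (volume.restrict (Icc 0 T)) :=
    (hVc.aemeasurable measurableSet_Icc).add (hum.const_mul _)
  have hψm : AEMeasurable ψ (volume.restrict (Icc 0 T)) := hum.mul (hum.const_sub 1)
  have hmono : volume.restrict (Icc a b) ≤ volume.restrict (Icc 0 T) :=
    Measure.restrict_mono hsub le_rfl
  have hφb : ∀ t ∈ Icc 0 T, |φ t| ≤ B + |2 * C| := fun t ht ↦ by
    have := hadm.control_mem t ht
    refine (abs_add_le _ _).trans (add_le_add (hB t ht) ?_)
    rw [abs_mul, abs_of_nonneg this.1]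
    exact mul_le_of_le_one_right (abs_nonneg _) this.2
  have hψ01 : ∀ t ∈ Icc 0 T, ψ t ∈ Icc (0 : ℝ) 1 := fun t ht ↦ by
    have := hadm.control_mem t ht
    refine ⟨mul_nonneg this.1 (sub_nonneg.2 this.2), ?_⟩
    simp only [hψdef]
    nlinarith [this.1, this.2]
  have : NeZero (volume.restrict (Icc a b)) := ⟨by simp [hab]⟩
  refine exists_ae_eq_const_of_orthogonal (A := B + |2 * C|) (B := 1) (φ := φ) (ψ := ψ)
    (hφm.mono_measure hmono).aestronglyMeasurable (hψm.mono_measure hmono).aestronglyMeasurable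
    ?_ ?_ ?_ fun m hm ↦ ?_
  · filter_upwards [ae_restrict_mem measurableSet_Icc] with t ht using hφb t (hsub ht)
  · filter_upwards [ae_restrict_mem measurableSet_Icc] with t ht
    rw [abs_of_nonneg (hψ01 t (hsub ht)).1]
    exact (hψ01 t (hsub ht)).2
  · filter_upwards [hint] with t ht using mul_pos ht.1 (sub_pos.2 ht.2)
  · set N := B + |2 * C| + |m| + 1 with hN
    have hNφ : ∀ t ∈ Icc 0 T, |φ t - m| ≤ N := fun t ht ↦ by
      linarith [abs_sub (φ t) m, hφb t ht]
    have hNpos : 0 < N := by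
      linarith [(abs_nonneg _).trans (hφb 0 (left_mem_Icc.2 hT)), abs_nonneg m]
    have hkψ : ∀ t ∈ Icc 0 T, |(Icc a b).indicator (fun t ↦ ψ t * (φ t - m)) t| ≤ ψ t * N := by
      intro t ht
      have h0 := (hψ01 t ht).1
      by_cases hm : t ∈ Icc a b
      · rw [indicator_of_mem hm, abs_mul, abs_of_nonneg h0]
        exact mul_le_mul_of_nonneg_left (hNφ t ht) h0
      · rw [indicator_of_notMem hm, abs_zero]
        positivity
    have key := hopt.integral_mul_eq_zero hT hx₀ hβ hP (M := N) (δ := 1 / N)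
      (k := (Icc a b).indicator fun t ↦ ψ t * (φ t - m)) (by positivity)
      ((hψm.mul (hφm.sub_const m)).indicator measurableSet_Icc)
      (fun t ht ↦ (hkψ t ht).trans (mul_le_of_le_one_left hNpos.le (hψ01 t ht).2))
      (by rw [intervalIntegral_indicator_Icc ha hb hT, hm]) (fun ε hε t ht ↦ ?_)
    · rw [← intervalIntegral_indicator_Icc ha hb hT]
      refine (intervalIntegral.integral_congr fun t _ ↦ ?_).trans key
      exact indicator_mul_right (Icc a b) φ (fun t ↦ ψ t * (φ t - m))
    · have h0 := (hψ01 t ht).1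
      have h1 : |ε * (Icc a b).indicator (fun t ↦ ψ t * (φ t - m)) t| ≤ ψ t := by
        rw [abs_mul]
        calc _ ≤ 1 / N * (ψ t * N) := by gcongr; exact hkψ t ht
          _ = ψ t := by field
      obtain ⟨h2, h3⟩ := abs_le.1 h1
      simp only [hψdef] at h2 h3 ⊢
      -- The margins are `u - u (1 - u) = u²` and `(1 - u) - u (1 - u) = (1 - u)²`.
      constructor <;> nlinarith [sq_nonneg (u t), sq_nonneg (1 - u t)]

/-! ### Regularity and monotonicity on the interior arc -/

theorem proposition1 (α β P π₀ C ρ x₀ T : ℝ)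
    (hα : 0 < α) (hβ : 0 < β) (hP : 0 < P) (hπ₀ : 0 ≤ π₀) (hC : 0 < C)
    (hρ : ρ ∈ Icc (0 : ℝ) 1) (hx₀ : x₀ ∈ Icc (0 : ℝ) 1) (hT : 0 < T)
    (x u : ℝ → ℝ) (hopt : IsOptimalPair α β P π₀ C ρ x₀ T x u)
    (a b : ℝ) (ha : 0 ≤ a) (hab : a < b) (hb : b ≤ T)
    (hint : ∀ᵐ t ∂(volume.restrict (Icc a b)), u t ∈ Ioo (0 : ℝ) 1) :
    ∃ v : ℝ → ℝ,
      (∀ᵐ t ∂(volume.restrict (Icc a b)), u t = v t) ∧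
      (ContinuousOn u (Icc a b) → EqOn u v (Icc a b)) ∧
      (∀ t ∈ Icc a b,
        HasDerivWithinAt x (β * (x t * (1 - x t)) * (P * v t - π₀)) (Icc a b) t) ∧
      (∀ t ∈ Icc a b,
        HasDerivWithinAt v (-(α * β * π₀ / (2 * C)) * (x t * (1 - x t))) (Icc a b) t) ∧
      AntitoneOn v (Icc a b) ∧
      (0 < π₀ → x₀ ∈ Ioo (0 : ℝ) 1 →
        (∀ t ∈ Icc a b, -(α * β * π₀ / (2 * C)) * (x t * (1 - x t)) < 0) ∧
        StrictAntiOn v (Icc a b)) := by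
  obtain ⟨m, hm⟩ := hopt.exists_ae_eq_const hT.le hx₀ hβ.ne' hP.ne' ha hab hb hint
  have hadm := hopt.1
  have hx := hadm.continuousOn_state
  have hxS := fun t ht ↦ (hadm.exp_integral_eq hT.le t ht).2
  have hsub : Icc a b ⊆ Icc 0 T := Icc_subset_Icc ha hb
  have hp : ContinuousOn (fun s ↦ α * β * π₀ * (x s * (1 - x s))) (Icc 0 T) :=
    continuousOn_const.mul (hx.mul (continuousOn_const.sub hx))
  set v : ℝ → ℝ := fun t ↦ (m - ∫ s in (0 : ℝ)..t, α * β * π₀ * (x s * (1 - x s))) / (2 * C)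
    with hv
  have huv : ∀ᵐ t ∂(volume.restrict (Icc a b)), u t = v t := by
    filter_upwards [hm] with t ht
    simp only [hv, ← ht]
    field
  have hdv : ∀ t ∈ Icc a b,
      HasDerivWithinAt v (-(α * β * π₀ / (2 * C)) * (x t * (1 - x t))) (Icc a b) t := by
    intro t ht
    convert! (((hp.hasDerivWithinAt_integral_Icc (hsub ht)).mono hsub).const_sub m).div_const
      (2 * C) using 1
    field
  have hvc : ContinuousOn v (Icc a b) := fun t ht ↦ (hdv t ht).continuousWithinAt
  have hder : ∀ t ∈ interior (Icc a b), deriv v t = -(α * β * π₀ / (2 * C)) * (x t * (1 - x t)) :=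
    fun t ht ↦ ((hdv t (interior_subset ht)).hasDerivAt (mem_interior_iff_mem_nhds.1 ht)).deriv
  refine ⟨v, huv, fun hu ↦ Measure.eqOn_Icc_of_ae_eq volume hab.ne huv hu hvc, ?_, hdv, ?_, ?_⟩
  · have hq : ContinuousOn (fun s ↦ β * (x s * (1 - x s)) * (P * v s - π₀)) (Icc a b) :=
      (continuousOn_const.mul ((hx.mul (continuousOn_const.sub hx)).mono hsub)).mul
        ((continuousOn_const.mul hvc).sub continuousOn_const)
    have hu := intervalIntegrable_of_mem_Icc hT.le hadm.aemeasurable_control hadm.control_mem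
    have hg : IntervalIntegrable (fun s ↦ β * (x s * (1 - x s)) * (P * u s - π₀)) volume 0 T :=
      ((hu.const_mul P).sub (by simp)).continuousOn_mul
        (uIcc_of_le hT.le ▸ continuousOn_const.mul (hx.mul (continuousOn_const.sub hx)))
    -- Replacing `u` by the continuous `v` leaves the integral unchanged and makes `x`
    -- differentiable everywhere on the arc.
    have hxq : ∀ t ∈ Icc a b,
        x t = x a + ∫ s in a..t, β * (x s * (1 - x s)) * (P * v s - π₀) := by
      intro t ht
      have haT := hsub (left_mem_Icc.2 hab.le)
      have hI : ∀ r ∈ Icc 0 T, IntervalIntegrable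
          (fun s ↦ β * (x s * (1 - x s)) * (P * u s - π₀)) volume 0 r := fun r hr ↦
        hg.mono_set (by
          rw [uIcc_of_le hr.1, uIcc_of_le hT.le]; exact Icc_subset_Icc_right hr.2)
      have hcongr : ∫ s in a..t, β * (x s * (1 - x s)) * (P * v s - π₀)
          = ∫ s in a..t, β * (x s * (1 - x s)) * (P * u s - π₀) := by
        refine intervalIntegral.integral_congr_ae ?_
        filter_upwards [(ae_restrict_iff' measurableSet_Icc).1 huv] with s hs hst
        rw [uIoc_of_le ht.1] at hst
        rw [hs ⟨hst.1.le, hst.2.trans ht.2⟩]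
      rw [hcongr, ← intervalIntegral.integral_interval_sub_left (hI t (hsub ht)) (hI a haT),
        hadm.state_eq t (hsub ht), hadm.state_eq a haT]
      ring
    intro t ht
    exact ((hq.hasDerivWithinAt_integral_Icc ht).const_add (x a)).congr hxq (hxq t ht)
  · refine antitoneOn_of_deriv_nonpos (convex_Icc a b) hvc
      (fun t ht ↦ ((hdv t (interior_subset ht)).mono interior_subset).differentiableWithinAt)
      fun t ht ↦ ?_
    rw [hder t ht, neg_mul, neg_nonpos, hxS t (hsub (interior_subset ht))]
    have := logisticFlow_mem_Icc hx₀ (∫ s in (0 : ℝ)..t, β * (P * u s - π₀))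
    exact mul_nonneg (by positivity) (mul_nonneg this.1 (sub_nonneg.2 this.2))
  · intro hπ hx₀'
    have hneg : ∀ t ∈ Icc a b, -(α * β * π₀ / (2 * C)) * (x t * (1 - x t)) < 0 := by
      intro t ht
      rw [neg_mul, neg_lt_zero, hxS t (hsub ht)]
      have := logisticFlow_mem_Ioo hx₀' (∫ s in (0 : ℝ)..t, β * (P * u s - π₀))
      exact mul_pos (by positivity) (mul_pos this.1 (sub_pos.2 this.2))
    refine ⟨hneg, strictAntiOn_of_deriv_neg (convex_Icc a b) hvc fun t ht ↦ ?_⟩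
    rw [hder t ht]
    exact hneg t (interior_subset ht)
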